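/- Let $n\ge 3$ be an integer and let $c\in\{0,1\}$ be such that $c\equiv\lfloor (n-1)/2\rfloor-1 \pmod 2$. For a colouring $f:E(K_n)\to\{-1,1\}$ of the edges of the complete graph $K_n$, write $e(-1)$ and $e(1)$ for the number of edges coloured $-1$ and $1$, respectively, and $f(H)=\sum_{e\in E(H)}f(e)$ for a subgraph $H$ of $K_n$; call $H$ zero-sum if $f(H)=0$ and almost zero-sum if $|f(H)|=1$. If $$\min\{e(-1),e(1)\}>\binom n2-\binom{n-\lfloor (n-3)/4\rfloor}{2}+c,$$ then $K_n$ has a spanning (that is, Hamiltonian) path which is zero-sum or almost zero-sum under $f$. Moreover, the bound is sharp: for every $n\ge3$ and the corresponding $c$ there is a colouring $f:E(K_n)\to\{-1,1\}$ with $$\min\{e(-1),e(1)\}=\binom n2-\binom{n-\lfloor (n-3)/4\rfloor}{2}+c$$ under which no spanning path of $K_n$ is zero-sum or almost zero-sum. -/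

import Mathlib

namespace ZeroSumPath

open scoped Classical in
/-- The number `e(a)` of edges of `G` that receive the colour `a` under the `±1`-colouring `f`. -/
noncomputable def colourCount {V : Type*} [Fintype V] {G : SimpleGraph V}
    (f : G.edgeSet → ({-1, 1} : Set ℤ)) (a : ℤ) : ℕ :=
  (Finset.univ.filter (fun e : G.edgeSet => (f e : ℤ) = a)).card

open scoped Classical in
/-- The weight `f(H)` of a subgraph `H` of `G`: the sum of the colours of the edges of `H`. -/
noncomputable def weight {V : Type*} [Fintype V] {G : SimpleGraph V}
    (f : G.edgeSet → ({-1, 1} : Set ℤ)) (H : G.Subgraph) : ℤ :=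
  ∑ e ∈ Finset.univ.filter (fun e : G.edgeSet => (e : Sym2 V) ∈ H.edgeSet), (f e : ℤ)

/-- `H` is zero-sum under `f`. -/
def IsZeroSum {V : Type*} [Fintype V] {G : SimpleGraph V}
    (f : G.edgeSet → ({-1, 1} : Set ℤ)) (H : G.Subgraph) : Prop :=
  weight f H = 0

/-- `H` is almost zero-sum under `f`. -/
def IsAlmostZeroSum {V : Type*} [Fintype V] {G : SimpleGraph V}
    (f : G.edgeSet → ({-1, 1} : Set ℤ)) (H : G.Subgraph) : Prop :=
  |weight f H| = 1

/-- `H` is a spanning (Hamiltonian) path of `G`: the subgraph traced by a walk in `G` that visits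
every vertex exactly once. -/
def IsSpanningPath {V : Type*} [DecidableEq V] {G : SimpleGraph V} (H : G.Subgraph) : Prop :=
  ∃ (u v : V) (p : G.Walk u v), p.IsHamiltonian ∧ H = p.toSubgraph

end ZeroSumPath

/-! Put `t = ⌊(n-3)/4⌋` and `s = 2t + c`. The congruence says that `s = ⌊(n-1)/2⌋ - 1`, so a
spanning path with at most `s` edges of colour `1` has weight at most `2s - (n-1) ≤ -2`, while one
with more has weight at least `-1`; likewise for colour `-1` with signs reversed.

Spanning paths are treated as orderings of the vertices. Reversing a prefix changes the weight by at
most 2, and such reversals connect all orderings, so a weight at least `-1` and a weight at most `1`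
force one in `[-1, 1]` (`exists_abs_pathSum_le_one`).

It remains to find, for each colour, a path with more than `s` edges of it. If there is none,
enlarge the graph of that colour to a maximal graph with this defect. A closure argument in the
style of Bondy and Chvátal bounds the degree sum of nonadjacent vertices by `s`, and counting
degrees then contradicts the number of edges (`sum_sum_adjInd_le`).

For sharpness, one colour consists of the edges meeting a fixed set of `t` vertices and `c` further
edges. A path has at most two edges at each vertex, hence at most `s` edges of this colour. -/

namespace ZeroSumPath

/-! ### Sums along vertex orderings and interpolation by prefix reversals -/

section Lists

variable {V : Type*}

/-- The sum of `w a b` over the pairs `a, b` of consecutive entries of a list. -/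
def pathSum (w : V → V → ℤ) : List V → ℤ
  | [] => 0
  | [_] => 0
  | a :: b :: l => w a b + pathSum w (b :: l)

/-- A list that contains every element exactly once. -/
def IsHamList (l : List V) : Prop := l.Nodup ∧ ∀ x, x ∈ l

lemma IsHamList.perm {l l' : List V} (hl : IsHamList l) (h : l.Perm l') : IsHamList l' :=
  ⟨h.nodup_iff.1 hl.1, fun x => h.mem_iff.1 (hl.2 x)⟩

lemma pathSum_append_cons_cons (w : V → V → ℤ) (l₁ l₂ : List V) (a b : V) :
    pathSum w (l₁ ++ a :: b :: l₂) = pathSum w (l₁ ++ [a]) + w a b + pathSum w (b :: l₂) := by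
  induction l₁ with
  | nil => simp [pathSum]
  | cons x l ih =>
    cases l with
    | nil => simp only [List.cons_append, List.nil_append, pathSum] at *; ring
    | cons y l => simp only [List.cons_append, pathSum] at *; rw [ih]; ring

lemma pathSum_append_of_eq (w : V → V → ℤ) {p q p' q' : List V} {a b : V} (hp : p = p' ++ [a])
    (hq : q = b :: q') : pathSum w (p ++ q) = pathSum w p + w a b + pathSum w q := by
  subst hp hq
  simpa using pathSum_append_cons_cons w p' q' a b

lemma pathSum_reverse {w : V → V → ℤ} (hw : ∀ a b, w a b = w b a) (l : List V) :
    pathSum w l.reverse = pathSum w l := by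
  induction l with
  | nil => rfl
  | cons x l ih =>
    cases l with
    | nil => rfl
    | cons y l =>
      rw [show (x :: y :: l).reverse = (y :: l).reverse ++ [x] by simp,
        pathSum_append_of_eq w (p' := l.reverse) (a := y) (by simp) rfl, ih, pathSum, hw y x]
      simp [pathSum]; ring

lemma pathSum_mono {w w' : V → V → ℤ} {l : List V}
    (h : ∀ l₁ l₂ a b, l = l₁ ++ a :: b :: l₂ → w a b ≤ w' a b) :
    pathSum w l ≤ pathSum w' l := by
  induction l with
  | nil => simp [pathSum]
  | cons x l ih =>
    cases l with
    | nil => simp [pathSum]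
    | cons y l =>
      have h1 := h [] l x y rfl
      have h2 := ih fun l₁ l₂ a b e => h (x :: l₁) l₂ a b (by rw [e]; rfl)
      simp only [pathSum]; linarith

lemma pathSum_congr {w w' : V → V → ℤ} {l : List V}
    (h : ∀ l₁ l₂ a b, l = l₁ ++ a :: b :: l₂ → w a b = w' a b) :
    pathSum w l = pathSum w' l :=
  le_antisymm (pathSum_mono fun l₁ l₂ a b e => (h l₁ l₂ a b e).le)
    (pathSum_mono fun l₁ l₂ a b e => (h l₁ l₂ a b e).ge)

lemma pathSum_add (w w' : V → V → ℤ) (l : List V) :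
    pathSum (fun a b => w a b + w' a b) l = pathSum w l + pathSum w' l := by
  induction l with
  | nil => simp [pathSum]
  | cons x l ih =>
    cases l with
    | nil => simp [pathSum]
    | cons y l => simp only [pathSum] at *; rw [ih]; ring

lemma pathSum_const (k : ℤ) {l : List V} (hl : l ≠ []) :
    pathSum (fun _ _ => k) l = k * (l.length - 1) := by
  induction l with
  | nil => simp at hl
  | cons x l ih =>
    cases l with
    | nil => simp [pathSum]
    | cons y l => simp only [pathSum]; rw [ih (by simp)]; push_cast [List.length_cons]; ring

/-- The last entry `v` begins no pair, so its value is absent from the sum. -/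
lemma pathSum_left (g : V → ℤ) (l : List V) (v : V) :
    pathSum (fun a _ => g a) (l ++ [v]) = (l.map g).sum := by
  induction l with
  | nil => simp [pathSum]
  | cons x l ih =>
    cases l with
    | nil => simp [pathSum]
    | cons y l => simp only [List.cons_append, pathSum, List.map_cons, List.sum_cons] at *; rw [ih]

lemma pathSum_right (g : V → ℤ) (l : List V) (u : V) :
    pathSum (fun _ b => g b) (u :: l) = (l.map g).sum := by
  induction l generalizing u with
  | nil => simp [pathSum]
  | cons x l ih => simp only [pathSum, List.map_cons, List.sum_cons]; rw [ih]

lemma IsHamList.sum_map [Fintype V] {l : List V} (hl : IsHamList l) (g : V → ℤ) :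
    (l.map g).sum = ∑ x, g x := by
  classical
  rw [← List.sum_toFinset g hl.1]
  congr 1
  ext x; simp [hl.2]

lemma IsHamList.length_eq [Fintype V] {l : List V} (hl : IsHamList l) :
    l.length = Fintype.card V := by
  classical
  rw [← List.toFinset_card_of_nodup hl.1, ← Finset.card_univ]
  congr 1
  ext x; simp [hl.2]

/-- Reversing a prefix of a list changes at most one pair of consecutive entries. -/
lemma abs_pathSum_reverse_append_sub_le {w : V → V → ℤ} (hw : ∀ a b, w a b = w b a)
    {p q : List V} (hd : (p ++ q).Nodup) (h1 : ∀ a b, a ≠ b → |w a b| = 1) :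
    |pathSum w (p.reverse ++ q) - pathSum w (p ++ q)| ≤ 2 := by
  rcases List.eq_nil_or_concat p with rfl | ⟨p', a, hp⟩
  · simp
  cases q with
  | nil => simp [pathSum_reverse hw]
  | cons b q =>
    obtain ⟨c, p'', hp'⟩ : ∃ c p'', p = c :: p'' := by
      cases p with
      | nil => simp at hp
      | cons c p'' => exact ⟨c, p'', rfl⟩
    have hab : a ≠ b := by
      rintro rfl
      rw [hp, List.nodup_append] at hd
      exact hd.2.2 a (by simp) a (by simp) rfl
    have hcb : c ≠ b := by
      rintro rfl
      rw [hp', List.nodup_append] at hd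
      exact hd.2.2 c (by simp) c (by simp) rfl
    rw [pathSum_append_of_eq w (p := p) (by simpa using hp) rfl,
      pathSum_append_of_eq w (p := p.reverse) (p' := p''.reverse) (a := c) (by simp [hp']) rfl,
      pathSum_reverse hw]
    have e1 := h1 a b hab
    have e2 := h1 c b hcb
    rw [abs_le] at *
    have f1 := abs_le.1 e1.le
    have f2 := abs_le.1 e2.le
    constructor <;> linarith

/-- A property of lists without repetition that is preserved by prefix reversals is preserved by
permutations. -/
lemma of_perm_of_reverse_append {Q : List V → Prop}
    (hQ : ∀ p q, Q (p ++ q) → Q (p.reverse ++ q)) {l l' : List V} (h : l.Perm l') (hl : Q l) :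
    Q l' := by
  suffices H : ∀ p, Q (p ++ l) → Q (p ++ l') from H [] hl
  clear hl
  induction h with
  | nil => exact fun _ h => h
  | cons x _ ih => intro p hp; simpa using ih (p ++ [x]) (by simpa using hp)
  | swap x y l =>
    intro p hp
    -- Three reversals make the swap: `p y x` becomes `x y p⁻¹`, then `y x p⁻¹`, then `p x y`, where
    -- `p⁻¹` is `p` reversed.
    have h1 := hQ (p ++ [y, x]) l (by simpa using hp)
    have h2 := hQ [x, y] (p.reverse ++ l) (by simpa using h1)
    simpa using hQ (y :: x :: p.reverse) l (by simpa using h2)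
  | trans _ _ ih1 ih2 => exact fun p hp => ih2 p (ih1 p hp)

/-- A symmetric `±1`-weighting whose sums along Hamiltonian paths take a value at least `-1` and a
value at most `1` takes a value in `[-1, 1]`. -/
lemma exists_abs_pathSum_le_one {w : V → V → ℤ} (hw : ∀ a b, w a b = w b a)
    (h1 : ∀ a b, a ≠ b → |w a b| = 1) {l l' : List V} (hl : IsHamList l) (hl' : IsHamList l')
    (hs : -1 ≤ pathSum w l) (hs' : pathSum w l' ≤ 1) :
    ∃ l, IsHamList l ∧ |pathSum w l| ≤ 1 := by
  by_contra! H
  have key : ∀ m, IsHamList m → -1 ≤ pathSum w m → 2 ≤ pathSum w m := fun m hm h => by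
    have := H m hm
    rw [lt_abs] at this
    omega
  have hp : l.Perm l' := (List.perm_ext_iff_of_nodup hl.1 hl'.1).2 fun x => by
    simp [hl.2 x, hl'.2 x]
  -- A step of size at most 2 from a value at least 2 lands at 0 or above, hence again at 2 or
  -- above: the gap cannot be jumped.
  have := of_perm_of_reverse_append (Q := fun m => IsHamList m ∧ 2 ≤ pathSum w m)
    (fun p q ⟨hm, h⟩ => by
      have hm' : IsHamList (p.reverse ++ q) :=
        hm.perm ((List.reverse_perm p).symm.append_right q)
      have := abs_le.1 (abs_pathSum_reverse_append_sub_le hw hm.1 h1)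
      exact ⟨hm', key _ hm' (by linarith)⟩) hp ⟨hl, key l hl hs⟩
  omega

end Lists

/-! ### Graphs in which no vertex ordering picks up more than `s` edges -/

section Extremal

variable {V : Type*}

open scoped Classical in
/-- The indicator of adjacency. -/
noncomputable def adjInd (G : SimpleGraph V) (a b : V) : ℤ := if G.Adj a b then 1 else 0

lemma adjInd_congr {G H : SimpleGraph V} {a b x y : V} (h : G.Adj a b ↔ H.Adj x y) :
    adjInd G a b = adjInd H x y := by
  by_cases h' : H.Adj x y <;> simp [adjInd, h, h']

lemma adjInd_comm (G : SimpleGraph V) (a b : V) : adjInd G a b = adjInd G b a :=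
  adjInd_congr (G.adj_comm a b)

lemma adjInd_self (G : SimpleGraph V) (a : V) : adjInd G a a = 0 := by simp [adjInd]

lemma adjInd_nonneg (G : SimpleGraph V) (a b : V) : 0 ≤ adjInd G a b := by
  unfold adjInd; split_ifs <;> simp

lemma adjInd_le_one (G : SimpleGraph V) (a b : V) : adjInd G a b ≤ 1 := by
  unfold adjInd; split_ifs <;> simp

variable [Fintype V]

/-- Closing up a Hamiltonian list does not help to pick up more edges. -/
lemma pathSum_add_adjInd_le {G : SimpleGraph V} {s : ℤ} (hs : s < Fintype.card V - 1)
    (hG : ∀ l : List V, IsHamList l → pathSum (adjInd G) l ≤ s) {l l' m' : List V} {x y : V}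
    (hl : IsHamList l) (hx : l = x :: l') (hy : l = m' ++ [y]) :
    pathSum (adjInd G) l + adjInd G y x ≤ s := by
  by_contra! H
  -- A non-edge on the closed-up cycle could be cut instead, giving an ordering with more than `s`
  -- edges. So all `|V| - 1` pairs are edges, which is also too many.
  have hall : ∀ l₁ l₂ a b, l = l₁ ++ a :: b :: l₂ → 1 ≤ adjInd G a b := by
    intro l₁ l₂ a b e
    by_contra! hab
    have hab0 : adjInd G a b = 0 := by have := adjInd_nonneg G a b; omega
    have e1 : l = (l₁ ++ [a]) ++ (b :: l₂) := by simp [e]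
    have hh := hG ((b :: l₂) ++ (l₁ ++ [a])) (hl.perm (by rw [e1]; exact List.perm_append_comm))
    obtain ⟨q, hq⟩ : ∃ q, l₁ ++ [a] = x :: q := by
      cases l₁ with
      | nil => simp [hx] at e; exact ⟨[], by simp [e]⟩
      | cons z l₁ => simp [hx] at e; exact ⟨l₁ ++ [a], by simp [e]⟩
    obtain ⟨r, hr⟩ : ∃ r, b :: l₂ = r ++ [y] := by
      rcases List.eq_nil_or_concat (b :: l₂) with h | ⟨r, z, h⟩
      · simp at h
      · refine ⟨r, ?_⟩
        rw [hy, h, List.concat_eq_append, ← List.append_assoc] at e1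
        have := List.append_inj_right' e1 rfl
        rw [h, this, List.concat_eq_append]
    rw [pathSum_append_of_eq _ hr hq] at hh
    rw [e, pathSum_append_cons_cons, hab0] at H
    linarith
  have h1 := pathSum_mono (w := fun _ _ => 1) hall
  rw [pathSum_const _ (by simp [hx]), hl.length_eq] at h1
  have := hG l hl
  linarith

/-- The ends of a Hamiltonian list that contains the most edges of `G` have small degree sum. -/
lemma sum_adjInd_add_le {G : SimpleGraph V} {s : ℤ} (hs : s < Fintype.card V - 1)
    (hG : ∀ l : List V, IsHamList l → pathSum (adjInd G) l ≤ s) {l l' m' : List V} {u v : V}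
    (hl : IsHamList l) (hu : l = u :: l') (hv : l = m' ++ [v]) (hsl : pathSum (adjInd G) l = s) :
    ∑ x, adjInd G u x + ∑ x, adjInd G v x ≤ s := by
  -- Reversing the tail from `b` on and closing up trades the pair `ab` for `av` and `bu`; the
  -- resulting cycle still has at most `s` edges. Summing over all pairs gives the two degrees on
  -- the left and `s` on the right.
  have hstep : ∀ l₁ l₂ a b, l = l₁ ++ a :: b :: l₂ →
      adjInd G v a + adjInd G u b ≤ adjInd G a b := by
    intro l₁ l₂ a b e
    have e1 : l = (l₁ ++ [a]) ++ (b :: l₂) := by simp [e]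
    obtain ⟨q, hq⟩ : ∃ q, l₁ ++ [a] = u :: q := by
      cases l₁ with
      | nil => simp [hu] at e; exact ⟨[], by simp [e]⟩
      | cons z l₁ => simp [hu] at e; exact ⟨l₁ ++ [a], by simp [e]⟩
    obtain ⟨r, hr⟩ : ∃ r, b :: l₂ = r ++ [v] := by
      rcases List.eq_nil_or_concat (b :: l₂) with h | ⟨r, z, h⟩
      · simp at h
      · refine ⟨r, ?_⟩
        have e2 := e1
        rw [hv, h, List.concat_eq_append, ← List.append_assoc] at e2
        have := List.append_inj_right' e2 rfl
        rw [h, this, List.concat_eq_append]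
    have hp : l.Perm ((l₁ ++ [a]) ++ (b :: l₂).reverse) := by
      rw [e1]; exact (List.reverse_perm _).symm.append_left _
    have hh := pathSum_add_adjInd_le hs hG (hl.perm hp)
      (l' := q ++ (b :: l₂).reverse) (x := u) (by rw [hq]; rfl)
      (m' := l₁ ++ [a] ++ l₂.reverse) (y := b) (by simp)
    rw [pathSum_append_of_eq _ (q' := r.reverse) (b := v) rfl (by rw [hr]; simp),
      pathSum_reverse (adjInd_comm G)] at hh
    rw [e, pathSum_append_cons_cons] at hsl
    have := adjInd_comm G a v
    have := adjInd_comm G b u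
    linarith
  have h1 := pathSum_mono (w := fun a b => adjInd G v a + adjInd G u b) hstep
  rw [pathSum_add (fun a _ => adjInd G v a) (fun _ b => adjInd G u b), hsl] at h1
  have h2 := hl.sum_map (adjInd G v)
  have h3 := hl.sum_map (adjInd G u)
  nth_rewrite 1 [hv] at h1
  rw [pathSum_left, hu, pathSum_right] at h1
  rw [hv] at h2
  rw [hu] at h3
  simp only [List.map_append, List.sum_append, List.map_cons, List.sum_cons, List.map_nil,
    List.sum_nil, adjInd_self] at h2 h3
  linarith

/-- A degree condition under which adding the edge `uv` does not help Hamiltonian lists to pick up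
more than `s` edges. -/
lemma pathSum_adjInd_sup_edge_le {G : SimpleGraph V} {s : ℤ} (hs : s < Fintype.card V - 1)
    (hG : ∀ l : List V, IsHamList l → pathSum (adjInd G) l ≤ s) {u v : V}
    (hd : s < ∑ x, adjInd G u x + ∑ x, adjInd G v x) (hadj : ¬ G.Adj u v) {l : List V}
    (hl : IsHamList l) : pathSum (adjInd (G ⊔ SimpleGraph.edge u v)) l ≤ s := by
  by_contra! H
  obtain ⟨l₁, l₂, a, b, e, hab⟩ : ∃ l₁ l₂ a b, l = l₁ ++ a :: b :: l₂ ∧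
      adjInd G a b < adjInd (G ⊔ SimpleGraph.edge u v) a b := by
    by_contra! h
    have := pathSum_mono (w := adjInd (G ⊔ SimpleGraph.edge u v)) (w' := adjInd G) (l := l)
      fun l₁ l₂ a b e => h l₁ l₂ a b e
    have := hG l hl
    linarith
  have hab' : (a = u ∧ b = v) ∨ (a = v ∧ b = u) := by
    by_contra h
    refine hab.ne ?_
    have : (SimpleGraph.edge u v).Adj a b ↔ False := by
      rw [SimpleGraph.edge_adj]; tauto
    exact adjInd_congr (by simp [this])
  have hnab : adjInd G a b = 0 := by
    rcases hab' with ⟨rfl, rfl⟩ | ⟨rfl, rfl⟩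
    · simp [adjInd, hadj]
    · rw [adjInd_comm]; simp [adjInd, hadj]
  have hcongr : ∀ x y, ¬ ((x = a ∧ y = b) ∨ (x = b ∧ y = a)) →
      adjInd (G ⊔ SimpleGraph.edge u v) x y = adjInd G x y := by
    intro x y h
    have : (SimpleGraph.edge u v).Adj x y ↔ False := by
      rw [SimpleGraph.edge_adj]
      rcases hab' with ⟨rfl, rfl⟩ | ⟨rfl, rfl⟩ <;> tauto
    exact adjInd_congr (by simp [this])
  have e1 : l = (l₁ ++ [a]) ++ (b :: l₂) := by simp [e]
  have hnd := hl.1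
  rw [e1, List.nodup_append] at hnd
  have hbl : b ∉ l₁ ++ [a] := fun h => hnd.2.2 b h b (by simp) rfl
  have hal : a ∉ b :: l₂ := fun h => hnd.2.2 a (by simp) a h rfl
  have c1 : pathSum (adjInd (G ⊔ SimpleGraph.edge u v)) (l₁ ++ [a]) =
      pathSum (adjInd G) (l₁ ++ [a]) := pathSum_congr fun p q x y h => hcongr x y <| by
    rintro (⟨-, rfl⟩ | ⟨rfl, -⟩) <;> exact hbl (by rw [h]; simp)
  have c2 : pathSum (adjInd (G ⊔ SimpleGraph.edge u v)) (b :: l₂) =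
      pathSum (adjInd G) (b :: l₂) := pathSum_congr fun p q x y h => hcongr x y <| by
    rintro (⟨rfl, -⟩ | ⟨-, rfl⟩) <;> exact hal (by rw [h]; simp)
  -- Exchanging the two pieces loses only the new edge, so at least `s` edges of `G` remain, and the
  -- ends are now `u` and `v`.
  have hm : IsHamList ((b :: l₂) ++ (l₁ ++ [a])) :=
    hl.perm (by rw [e1]; exact List.perm_append_comm)
  have hsum : s ≤ pathSum (adjInd G) ((b :: l₂) ++ (l₁ ++ [a])) := by
    obtain ⟨r, y, hr⟩ : ∃ r y, b :: l₂ = r ++ [y] := by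
      rcases List.eq_nil_or_concat (b :: l₂) with h | ⟨r, z, h⟩
      · simp at h
      · exact ⟨r, z, by simp [h]⟩
    obtain ⟨q, x, hq⟩ : ∃ q x, l₁ ++ [a] = x :: q := by
      cases l₁ with
      | nil => exact ⟨[], a, rfl⟩
      | cons z l₁ => exact ⟨l₁ ++ [a], z, rfl⟩
    rw [pathSum_append_of_eq _ hr hq]
    rw [e, pathSum_append_cons_cons, c1, c2] at H
    have := adjInd_nonneg G y x
    have := adjInd_le_one (G ⊔ SimpleGraph.edge u v) a b
    linarith
  have := sum_adjInd_add_le hs hG hm (l' := l₂ ++ (l₁ ++ [a])) (u := b) (by simp)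
    (m' := b :: l₂ ++ l₁) (v := a) (by simp) (le_antisymm (hG _ hm) hsum)
  rcases hab' with ⟨rfl, rfl⟩ | ⟨rfl, rfl⟩ <;> linarith

/-- If every Hamiltonian list contains at most `s` edges of `G`, with `2 s + 3 ≤ |V|`, then the
degree sum of `G` is bounded as in Erdős' theorem on non-Hamiltonian graphs. -/
theorem sum_sum_adjInd_le {G : SimpleGraph V} {s t : ℕ} (hs : 2 * s + 3 ≤ Fintype.card V)
    (hst : s ≤ 2 * t + 1) (hts : 2 * t ≤ s)
    (hG : ∀ l : List V, IsHamList l → pathSum (adjInd G) l ≤ s) :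
    ∑ x, ∑ y, adjInd G x y ≤ 3 * (t : ℤ) ^ 2 + t * (2 * (Fintype.card V : ℤ) - 3 - 4 * s) +
      s ^ 2 + s := by
  classical
  have hs' : (s : ℤ) < Fintype.card V - 1 := by omega
  obtain ⟨K, hGK, hK, hmax⟩ := Finite.exists_le_maximal
    (p := fun K : SimpleGraph V => ∀ l : List V, IsHamList l → pathSum (adjInd K) l ≤ s) hG
  have hmono : ∑ x, ∑ y, adjInd G x y ≤ ∑ x, ∑ y, adjInd K x y := by
    refine Finset.sum_le_sum fun x _ => Finset.sum_le_sum fun y _ => ?_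
    by_cases h : G.Adj x y
    · simp [adjInd, h, hGK h]
    · have := adjInd_nonneg K x y
      simpa [adjInd, h] using this
  refine hmono.trans ?_
  clear hmono hGK hG
  set d : V → ℤ := fun x => ∑ y, adjInd K x y with hd
  have hclosure : ∀ u v, u ≠ v → ¬ K.Adj u v → d u + d v ≤ s := by
    intro u v huv hadj
    by_contra! h
    have h1 := hmax (fun l hl => pathSum_adjInd_sup_edge_le hs' hK h hadj hl) le_sup_left
    exact hadj (h1 (Or.inr (by simp [SimpleGraph.edge_adj, huv])))
  have hd_le : ∀ x, d x ≤ Fintype.card V - 1 := by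
    intro x
    have h : d x ≤ ∑ y, if y = x then (0 : ℤ) else 1 := by
      refine Finset.sum_le_sum fun y _ => ?_
      split_ifs with hy
      · rw [hy, adjInd_self]
      · exact adjInd_le_one K x y
    rw [Finset.sum_ite, Finset.sum_const_zero, Finset.sum_const, Finset.filter_ne',
      Finset.card_erase_of_mem (Finset.mem_univ _), Finset.card_univ] at h
    simp only [nsmul_eq_mul, mul_one, zero_add] at h
    omega
  -- a pair of nonadjacent vertices of maximal degree sum
  obtain ⟨u, v, huv, hadj, hle, hbest⟩ : ∃ u v, u ≠ v ∧ ¬ K.Adj u v ∧ d u ≤ d v ∧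
      ∀ x y, x ≠ y → ¬ K.Adj x y → d x + d y ≤ d u + d v := by
    have hne : (Finset.univ.filter fun q : V × V => q.1 ≠ q.2 ∧ ¬ K.Adj q.1 q.2).Nonempty := by
      by_contra hemp
      have hcomp : ∀ x y, x ≠ y → K.Adj x y := by
        intro x y hxy
        by_contra hn
        exact hemp ⟨(x, y), by simp [hxy, hn]⟩
      have hl : IsHamList (Finset.univ : Finset V).toList :=
        ⟨Finset.nodup_toList _, fun x => by simp⟩
      have h1 := hK _ hl
      have h2 : pathSum (fun _ _ => (1 : ℤ)) (Finset.univ : Finset V).toList ≤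
          pathSum (adjInd K) (Finset.univ : Finset V).toList := pathSum_mono fun l₁ l₂ a b e => by
        have hnd := hl.1
        rw [e, List.nodup_append] at hnd
        have hab : a ≠ b := by
          rintro rfl
          simpa using hnd.2.1
        simp [adjInd, hcomp a b hab]
      rw [pathSum_const _ (by
        intro h
        have := hl.length_eq
        rw [h] at this
        simp at this
        omega), hl.length_eq] at h2
      omega
    obtain ⟨⟨u, v⟩, hq, hm⟩ := Finset.exists_max_image _ (fun q : V × V => d q.1 + d q.2) hne
    simp only [Finset.mem_filter, Finset.mem_univ, true_and, Prod.forall] at hq hm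
    rcases le_total (d u) (d v) with h | h
    · exact ⟨u, v, hq.1, hq.2, h, fun x y h1 h2 => hm x y ⟨h1, h2⟩⟩
    · exact ⟨v, u, hq.1.symm, fun h => hq.2 h.symm, h, fun x y h1 h2 => by
        have := hm x y ⟨h1, h2⟩; linarith⟩
  have hsum := hclosure u v huv hadj
  have hu0 : 0 ≤ d u := Finset.sum_nonneg fun y _ => adjInd_nonneg K u y
  -- pointwise bound on the degrees
  have hpt : ∀ x, d x ≤ d v + (Fintype.card V - 1 - d v) * adjInd K u x -
      (d v - d u) * (1 - adjInd K v x - if x = v then 1 else 0) := by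
    intro x
    have h1 := hd_le x
    have h2 := hd_le v
    by_cases hxv : x = v
    · subst hxv
      simp [adjInd, hadj]
    -- The choice of `u, v` enters here: a non-neighbour of `v` of degree above `d u` would form a
    -- better pair with `v`.
    have hA : adjInd K v x = 0 → d x ≤ d u := fun h => by
      have hvx : ¬ K.Adj x v := fun h' => by simp [adjInd, h'.symm] at h
      have := hbest x v hxv hvx
      linarith
    have hB : adjInd K u x = 0 → d x ≤ d v := fun h => by
      by_cases hxu : x = u
      · rw [hxu]; exact hle
      have hux : ¬ K.Adj x u := fun h' => by simp [adjInd, h'.symm] at h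
      have := hbest x u hxu hux
      linarith
    have hvx : adjInd K v x = 0 ∨ adjInd K v x = 1 := by unfold adjInd; split_ifs <;> simp
    have hux : adjInd K u x = 0 ∨ adjInd K u x = 1 := by unfold adjInd; split_ifs <;> simp
    rw [if_neg hxv]
    rcases hvx with e1 | e1 <;> rcases hux with e2 | e2 <;> rw [e1, e2]
    · linarith [hA e1]
    · linarith [hA e1]
    · linarith [hB e2]
    · linarith
  have htot := Finset.sum_le_sum fun x (_ : x ∈ Finset.univ) => hpt x
  simp only [Finset.sum_sub_distrib, Finset.sum_add_distrib, ← Finset.mul_sum, Finset.sum_const,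
    Finset.sum_ite_eq', Finset.mem_univ, if_true, Finset.card_univ, nsmul_eq_mul, mul_one] at htot
  change _ ≤ (Fintype.card V : ℤ) * d v + (Fintype.card V - 1 - d v) * d u -
    (d v - d u) * (Fintype.card V - d v - 1) at htot
  refine htot.trans ?_
  generalize d u = h at *
  generalize d v = D at *
  have hN : 2 * (s : ℤ) + 3 ≤ Fintype.card V := by exact_mod_cast hs
  generalize (Fintype.card V : ℤ) = N at *
  have hht : h ≤ t := by omega
  -- The bound grows with `D`, so `D` is raised to `s - h`; it then grows with `h`, which is raised
  -- to `t`.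
  have hmonoD : (N * D + (N - 1 - D) * h - (D - h) * (N - D - 1)) ≤
      3 * h ^ 2 + h * (2 * N - 3 - 4 * s) + s ^ 2 + s := by
    have : 0 ≤ (s - h - D) * (s - h + D + 1 - 2 * h) :=
      mul_nonneg (by linarith) (by linarith)
    nlinarith
  have hmonoh : 0 ≤ ((t : ℤ) - h) * (3 * (t + h) + 2 * N - 3 - 4 * s) :=
    mul_nonneg (by linarith) (by linarith)
  nlinarith

end Extremal

/-! ### From edge colourings to weights of vertex orderings -/

section Colourings

variable {V : Type*}

open scoped Classical in
/-- A colouring of the edges, extended by `0` to all unordered pairs. -/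
noncomputable def extendColour {G : SimpleGraph V} (f : G.edgeSet → ({-1, 1} : Set ℤ))
    (e : Sym2 V) : ℤ :=
  if h : e ∈ G.edgeSet then (f ⟨e, h⟩ : ℤ) else 0

lemma extendColour_coe {G : SimpleGraph V} (f : G.edgeSet → ({-1, 1} : Set ℤ)) (e : G.edgeSet) :
    extendColour f e = f e := by
  simp [extendColour]

lemma extendColour_eq_or {G : SimpleGraph V} (f : G.edgeSet → ({-1, 1} : Set ℤ)) {e : Sym2 V}
    (h : e ∈ G.edgeSet) : extendColour f e = -1 ∨ extendColour f e = 1 := by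
  rw [extendColour, dif_pos h]
  exact (f ⟨e, h⟩).2

lemma sum_map_edges_eq_pathSum {G : SimpleGraph V} (g : Sym2 V → ℤ) {u v : V} (p : G.Walk u v) :
    (p.edges.map g).sum = pathSum (fun a b => g s(a, b)) p.support := by
  induction p with
  | nil => simp [pathSum]
  | cons h p ih =>
    rw [SimpleGraph.Walk.edges_cons, List.map_cons, List.sum_cons, ih,
      SimpleGraph.Walk.support_cons, ← SimpleGraph.Walk.cons_tail_support p]
    simp [pathSum]

lemma weight_toSubgraph [Fintype V] {G : SimpleGraph V} (f : G.edgeSet → ({-1, 1} : Set ℤ))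
    {u v : V} {p : G.Walk u v} (hp : p.IsPath) :
    weight f p.toSubgraph = pathSum (fun a b => extendColour f s(a, b)) p.support := by
  classical
  rw [← sum_map_edges_eq_pathSum, ← List.sum_toFinset _ hp.isTrail.edges_nodup, weight]
  refine Finset.sum_nbij (fun e => (e : Sym2 V)) ?_ ?_ ?_ ?_
  · intro e he
    simpa using he
  · exact fun _ _ _ _ h => Subtype.ext h
  · intro e he
    have he' : e ∈ p.edges := by simpa using he
    exact ⟨⟨e, p.edges_subset_edgeSet he'⟩, by simpa using he', rfl⟩
  · exact fun e _ => (extendColour_coe f e).symm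

/-- Spanning paths of a complete graph correspond to Hamiltonian lists. -/
lemma exists_isSpanningPath_iff [Fintype V] [DecidableEq V] [Nonempty V]
    (f : (⊤ : SimpleGraph V).edgeSet → ({-1, 1} : Set ℤ)) (P : ℤ → Prop) :
    (∃ H : (⊤ : SimpleGraph V).Subgraph, IsSpanningPath H ∧ P (weight f H)) ↔
      ∃ l : List V, IsHamList l ∧ P (pathSum (fun a b => extendColour f s(a, b)) l) := by
  constructor
  · rintro ⟨H, ⟨u, v, p, hp, rfl⟩, h⟩
    rw [weight_toSubgraph f hp.isPath] at h
    exact ⟨p.support, ⟨hp.isPath.support_nodup, hp.mem_support⟩, h⟩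
  · rintro ⟨l, hl, h⟩
    have hne : l ≠ [] := List.ne_nil_of_mem (hl.2 (Classical.arbitrary V))
    have hc : l.IsChain (⊤ : SimpleGraph V).Adj :=
      List.Pairwise.isChain (hl.1.imp fun h => by simpa using h)
    have hs := SimpleGraph.Walk.support_ofSupport hne hc
    have hp : (SimpleGraph.Walk.ofSupport l hne hc).IsPath :=
      SimpleGraph.Walk.IsPath.mk' (by rw [hs]; exact hl.1)
    refine ⟨_, ⟨_, _, _, hp.isHamiltonian_of_mem fun w => by rw [hs]; exact hl.2 w, rfl⟩, ?_⟩
    rw [weight_toSubgraph f hp, hs]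
    exact h

/-- The spanning subgraph of the edges of colour `k`. -/
def colourGraph {G : SimpleGraph V} (f : G.edgeSet → ({-1, 1} : Set ℤ)) (k : ℤ) :
    SimpleGraph V :=
  SimpleGraph.fromEdgeSet {e | extendColour f e = k}

lemma sum_sum_adjInd_colourGraph [Fintype V] {G : SimpleGraph V}
    (f : G.edgeSet → ({-1, 1} : Set ℤ)) {k : ℤ} (hk : k ≠ 0) :
    ∑ x, ∑ y, adjInd (colourGraph f k) x y = 2 * colourCount f k := by
  classical
  have h1 : ∀ x, ∑ y, adjInd (colourGraph f k) x y = (colourGraph f k).degree x := by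
    intro x
    simp only [adjInd]
    rw [Finset.sum_boole, ← SimpleGraph.card_neighborFinset_eq_degree,
      SimpleGraph.neighborFinset_eq_filter]
  have hmem : ∀ e, e ∈ (colourGraph f k).edgeFinset ↔ extendColour f e = k ∧ ¬ e.IsDiag := by
    intro e
    rw [SimpleGraph.mem_edgeFinset, colourGraph, SimpleGraph.edgeSet_fromEdgeSet]
    rfl
  have h2 : colourCount f k = (colourGraph f k).edgeFinset.card := by
    refine Finset.card_nbij (fun e => (e : Sym2 V)) ?_ ?_ ?_
    · intro e he
      have he' : (f e : ℤ) = k := by simpa using he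
      exact (hmem _).2 ⟨by simpa [extendColour_coe] using he', G.not_isDiag_of_mem_edgeSet e.2⟩
    · exact fun _ _ _ _ h => Subtype.ext h
    · intro e he
      have he' : extendColour f e = k := ((hmem e).1 he).1
      have hG : e ∈ G.edgeSet := by
        -- Off the edges of `G` the extended colour is 0, which `k ≠ 0` excludes.
        by_contra hG
        rw [extendColour, dif_neg hG] at he'
        exact hk he'.symm
      refine ⟨⟨e, hG⟩, ?_, rfl⟩
      rw [extendColour, dif_pos hG] at he'
      simpa using he'
  simp_rw [h1]
  rw [h2]
  exact_mod_cast (colourGraph f k).sum_degrees_eq_twice_card_edges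

lemma two_mul_choose_two (m : ℕ) : 2 * (m.choose 2 : ℤ) = m * (m - 1) := by
  have h := Nat.cast_choose_two ℚ m
  have : ((2 * (m.choose 2 : ℤ) : ℤ) : ℚ) = ((m * (m - 1) : ℤ) : ℚ) := by push_cast; rw [h]; ring
  exact_mod_cast this

/-- Enough edges of colour `k` force a Hamiltonian list with more than `2 t + c` edges of
colour `k`. -/
lemma exists_lt_pathSum_colourGraph [Fintype V] {G : SimpleGraph V}
    (f : G.edgeSet → ({-1, 1} : Set ℤ)) {k : ℤ} (hk : k ≠ 0) {t c : ℕ} (hc : c = 0 ∨ c = 1)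
    (hV : 2 * (2 * t + c) + 3 ≤ Fintype.card V)
    (h : (Fintype.card V).choose 2 - (Fintype.card V - t).choose 2 + c < colourCount f k) :
    ∃ l : List V, IsHamList l ∧ (2 * t + c : ℤ) < pathSum (adjInd (colourGraph f k)) l := by
  by_contra! H
  have h1 := sum_sum_adjInd_le (G := colourGraph f k) (s := 2 * t + c) (t := t) hV (by omega)
    (by omega) (by exact_mod_cast H)
  rw [sum_sum_adjInd_colourGraph f hk] at h1
  have h2 := two_mul_choose_two (Fintype.card V)
  have h3 := two_mul_choose_two (Fintype.card V - t)
  rw [Nat.cast_sub (by omega)] at h3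
  have h4 : ((Fintype.card V).choose 2 : ℤ) - (Fintype.card V - t).choose 2 + c
      < colourCount f k := by omega
  push_cast at h1
  -- With `s = 2t + c` and `c² = c`, the degree-sum bound is exactly twice the assumed edge
  -- threshold.
  have hc2 : (c : ℤ) ^ 2 = c := by rcases hc with rfl | rfl <;> simp
  nlinarith

/-- If both colours have many edges, then some Hamiltonian list is balanced up to one edge. -/
lemma exists_abs_pathSum_extendColour_le_one [Fintype V]
    (f : (⊤ : SimpleGraph V).edgeSet → ({-1, 1} : Set ℤ)) {t c : ℕ} (hc : c = 0 ∨ c = 1)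
    (hV : 2 * (2 * t + c) + 3 ≤ Fintype.card V) (hV' : Fintype.card V ≤ 2 * (2 * t + c) + 4)
    (h : (Fintype.card V).choose 2 - (Fintype.card V - t).choose 2 + c <
      min (colourCount f (-1)) (colourCount f 1)) :
    ∃ l : List V, IsHamList l ∧ |pathSum (fun a b => extendColour f s(a, b)) l| ≤ 1 := by
  obtain ⟨l, hl, hsl⟩ := exists_lt_pathSum_colourGraph f (k := 1) (by simp) hc hV
    (h.trans_le (min_le_right _ _))
  obtain ⟨l', hl', hsl'⟩ := exists_lt_pathSum_colourGraph f (k := -1) (by simp) hc hV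
    (h.trans_le (min_le_left _ _))
  -- On a pair of distinct vertices, `k` times the colour is twice the indicator of colour `k`,
  -- minus 1.
  have hsub : ∀ k : ℤ, k = 1 ∨ k = -1 → ∀ m : List V, IsHamList m →
      pathSum (fun a b => k * extendColour f s(a, b)) m =
        2 * pathSum (adjInd (colourGraph f k)) m - (Fintype.card V - 1) := by
    intro k hk m hm
    have hne : m ≠ [] := by
      rintro rfl
      have := hm.length_eq
      simp at this
      omega
    have e : pathSum (fun a b => k * extendColour f s(a, b)) m =
        pathSum (fun a b => (adjInd (colourGraph f k) a b + adjInd (colourGraph f k) a b) + -1)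
          m := by
      refine pathSum_congr fun p q a b e => ?_
      have hab : a ≠ b := by
        rintro rfl
        have := hm.1
        rw [e, List.nodup_append] at this
        simpa using this.2.1
      have hor := extendColour_eq_or f (e := s(a, b)) (by simpa using hab)
      have hadj : (colourGraph f k).Adj a b ↔ extendColour f s(a, b) = k := by
        simp [colourGraph, hab]
      simp only [adjInd, hadj]
      rcases hk with rfl | rfl <;> rcases hor with h | h <;> simp [h]
    rw [e, pathSum_add, pathSum_add, pathSum_const _ hne, hm.length_eq]
    ring
  have hneg : ∀ m : List V, pathSum (fun a b => -1 * extendColour f s(a, b)) m +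
      pathSum (fun a b => extendColour f s(a, b)) m = 0 := by
    intro m
    rw [← pathSum_add]
    cases m with
    | nil => rfl
    | cons x m => simpa using pathSum_const 0 (l := x :: m) (by simp)
  refine exists_abs_pathSum_le_one (fun a b => by rw [Sym2.eq_swap]) ?_ hl hl' ?_ ?_
  · intro a b hab
    rcases extendColour_eq_or f (e := s(a, b)) (by simpa using hab) with h | h <;> rw [h] <;> rfl
  · have := hsub 1 (Or.inl rfl) l hl
    simp only [one_mul] at this
    omega
  · have := hsub (-1) (Or.inr rfl) l' hl'
    have := hneg l'
    omega

end Colourings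

/-! ### The extremal colouring -/

section Sharpness

variable {V : Type*}

/-- A list without repetition runs through a given edge at most once. -/
lemma pathSum_edge_indicator_le_one [DecidableEq V] (e : Sym2 V) {l : List V} (hl : l.Nodup) :
    pathSum (fun a b => if s(a, b) = e then (1 : ℤ) else 0) l ≤ 1 := by
  induction l with
  | nil => simp [pathSum]
  | cons x l ih =>
    cases l with
    | nil => simp [pathSum]
    | cons y l =>
      have h := ih hl.of_cons
      simp only [pathSum]
      split_ifs with hxy
      · have h0 : pathSum (fun a b => if s(a, b) = e then (1 : ℤ) else 0) (y :: l) =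
            pathSum (fun _ _ => 0) (y :: l) := pathSum_congr fun p q a b hab => by
          rw [if_neg]
          intro he
          have hx : x ∈ s(a, b) := by rw [he, ← hxy]; simp
          refine (List.nodup_cons.1 hl).1 ?_
          rw [hab]
          rcases Sym2.mem_iff.1 hx with rfl | rfl <;> simp
        rw [h0, pathSum_const _ (by simp)]
        simp
      · simpa using h

/-- The colouring with value `-1` exactly on the edges in `B`. -/
def indicatorColour [DecidableEq V] (G : SimpleGraph V) (B : Finset (Sym2 V)) :
    G.edgeSet → ({-1, 1} : Set ℤ) :=
  fun e => if (e : Sym2 V) ∈ B then ⟨-1, by simp⟩ else ⟨1, by simp⟩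

lemma coe_indicatorColour [DecidableEq V] (G : SimpleGraph V) (B : Finset (Sym2 V))
    (e : G.edgeSet) : (indicatorColour G B e : ℤ) = if (e : Sym2 V) ∈ B then -1 else 1 := by
  unfold indicatorColour; split_ifs <;> rfl

lemma colourCount_indicatorColour_neg_one [Fintype V] [DecidableEq V] (G : SimpleGraph V)
    {B : Finset (Sym2 V)} (hB : ∀ e ∈ B, e ∈ G.edgeSet) :
    colourCount (indicatorColour G B) (-1) = B.card := by
  classical
  refine Finset.card_nbij (fun e => (e : Sym2 V)) ?_ ?_ ?_
  · intro e he
    by_contra hn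
    simp [coe_indicatorColour, show (e : Sym2 V) ∉ B by simpa using hn] at he
  · exact fun _ _ _ _ h => Subtype.ext h
  · intro e he
    have he' : e ∈ B := by simpa using he
    exact ⟨⟨e, hB e he'⟩, by simp [coe_indicatorColour, he'], rfl⟩

lemma colourCount_neg_one_add_colourCount_one [Fintype V]
    (f : (⊤ : SimpleGraph V).edgeSet → ({-1, 1} : Set ℤ)) :
    colourCount f (-1) + colourCount f 1 = (Fintype.card V).choose 2 := by
  classical
  have h1 : colourCount f 1 = (Finset.univ.filter fun e => ¬ (f e : ℤ) = -1).card := by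
    refine congrArg Finset.card (Finset.ext fun e => ?_)
    have := (f e).2
    simp only [Set.mem_insert_iff, Set.mem_singleton_iff] at this
    simp only [Finset.mem_filter, Finset.mem_univ, true_and]
    omega
  have h2 : colourCount f (-1) = (Finset.univ.filter fun e => (f e : ℤ) = -1).card :=
    congrArg Finset.card (Finset.ext fun e => by simp)
  rw [h1, h2, Finset.card_filter_add_card_filter_not, Finset.card_univ,
    ← SimpleGraph.card_edgeFinset_top_eq_card_choose_two, SimpleGraph.edgeFinset_card]

/-- A colouring in which every Hamiltonian list has few edges of colour `1`: these are the edges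
that meet `T`, together with the edges in `E`, at most one. -/
lemma pathSum_indicatorColour_le [Fintype V] [DecidableEq V] [Nonempty V] {T : Finset V}
    {E : Finset (Sym2 V)} (hE : E.card ≤ 1) {l : List V} (hl : IsHamList l) :
    pathSum (fun a b => extendColour (indicatorColour (⊤ : SimpleGraph V)
      (Tᶜ.offDiag.image (Function.uncurry Sym2.mk) \ E)) s(a, b)) l ≤
      2 * (2 * T.card + E.card) - (Fintype.card V - 1) := by
  have hne : l ≠ [] := List.ne_nil_of_mem (hl.2 (Classical.arbitrary V))
  set g : V → ℤ := fun x => if x ∈ T then 1 else 0 with hg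
  -- An upper bound for the indicator of colour `1`; edges inside `T` are counted twice, which does
  -- no harm.
  set r : V → V → ℤ := fun a b => (g a + g b) + if s(a, b) ∈ E then (1 : ℤ) else 0 with hr
  have h1 : pathSum (fun a b => extendColour (indicatorColour (⊤ : SimpleGraph V)
      (Tᶜ.offDiag.image (Function.uncurry Sym2.mk) \ E)) s(a, b)) l ≤
      pathSum (fun a b => (r a b + r a b) + -1) l := by
    refine pathSum_mono fun p q a b e => ?_
    have hab : a ≠ b := by
      rintro rfl
      have := hl.1
      rw [e, List.nodup_append] at this
      simpa using this.2.1
    have hmem : s(a, b) ∈ (⊤ : SimpleGraph V).edgeSet := by simpa using hab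
    have := extendColour_coe (indicatorColour (⊤ : SimpleGraph V)
      (Tᶜ.offDiag.image (Function.uncurry Sym2.mk) \ E)) ⟨_, hmem⟩
    simp only at this
    rw [this, coe_indicatorColour]
    by_cases ha : a ∈ T
    · simp only [hr, hg, ha]; split_ifs <;> simp
    by_cases hb : b ∈ T
    · simp only [hr, hg, hb]; split_ifs <;> simp
    by_cases hE : s(a, b) ∈ E
    · simp [hr, hg, ha, hb, hE]
    · have : s(a, b) ∈ Tᶜ.offDiag.image (Function.uncurry Sym2.mk) \ E :=
        Finset.mem_sdiff.2 ⟨Finset.mem_image.2 ⟨(a, b), by simp [ha, hb, hab], rfl⟩, hE⟩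
      rw [if_pos this]
      simp [hr, hg, ha, hb, hE]
  have hg0 : ∀ x, 0 ≤ g x := fun x => by simp only [hg]; split_ifs <;> simp
  have hgs : (l.map g).sum = T.card := by rw [hl.sum_map]; simp [hg]
  have hL : pathSum (fun a _ => g a) l ≤ T.card := by
    rcases List.eq_nil_or_concat l with h | ⟨m, v, h⟩
    · exact absurd h hne
    · rw [List.concat_eq_append] at h
      rw [h] at hgs ⊢
      rw [pathSum_left]
      simp only [List.map_append, List.sum_append, List.map_cons, List.sum_cons, List.map_nil,
        List.sum_nil] at hgs
      linarith [hg0 v]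
  have hR : pathSum (fun _ b => g b) l ≤ T.card := by
    cases l with
    | nil => exact absurd rfl hne
    | cons u m =>
      rw [pathSum_right]
      simp only [List.map_cons, List.sum_cons] at hgs
      linarith [hg0 u]
  have hM : pathSum (fun a b => if s(a, b) ∈ E then (1 : ℤ) else 0) l ≤ E.card := by
    rcases Finset.eq_empty_or_nonempty E with rfl | hE'
    · simp [pathSum_const 0 hne]
    · obtain ⟨e, rfl⟩ := Finset.card_eq_one.1 (le_antisymm hE hE'.card_pos)
      simpa using pathSum_edge_indicator_le_one e hl.1
  have h2 : pathSum r l = pathSum (fun a _ => g a) l + pathSum (fun _ b => g b) l +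
      pathSum (fun a b => if s(a, b) ∈ E then (1 : ℤ) else 0) l := by
    rw [hr, pathSum_add, pathSum_add]
  rw [pathSum_add, pathSum_add, pathSum_const _ hne, hl.length_eq] at h1
  linarith

/-- The extremal colouring: it has the stated number of edges of the rarer colour, and all its
spanning paths are far from balanced. -/
lemma exists_unbalanced_colouring [Fintype V] {t c : ℕ} (hc : c = 0 ∨ c = 1)
    (hV : 2 * (2 * t + c) + 3 ≤ Fintype.card V) :
    ∃ f : (⊤ : SimpleGraph V).edgeSet → ({-1, 1} : Set ℤ),
      min (colourCount f (-1)) (colourCount f 1) =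
        (Fintype.card V).choose 2 - (Fintype.card V - t).choose 2 + c ∧
      ∀ l : List V, IsHamList l → pathSum (fun a b => extendColour f s(a, b)) l ≤ -2 := by
  classical
  have : Nonempty V := Fintype.card_pos_iff.1 (by omega)
  obtain ⟨T, -, hT⟩ := Finset.exists_subset_card_eq
    (show t ≤ (Finset.univ : Finset V).card by rw [Finset.card_univ]; omega)
  have hTc : Tᶜ.card = Fintype.card V - t := by rw [Finset.card_compl, hT]
  have hB := Sym2.card_image_offDiag Tᶜ
  rw [hTc] at hB
  have h2 := two_mul_choose_two (Fintype.card V)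
  have h3 := two_mul_choose_two (Fintype.card V - t)
  rw [Nat.cast_sub (by omega)] at h3
  have hVZ : 2 * (2 * (t : ℤ) + c) + 3 ≤ Fintype.card V := by exact_mod_cast hV
  have hc01 : 0 ≤ (c : ℤ) ∧ (c : ℤ) ≤ 1 := by omega
  -- This makes colour `1` the rarer one, so that the minimum is its count.
  have hrare : ((Fintype.card V).choose 2 : ℤ) + 2 * c ≤ 2 * (Fintype.card V - t).choose 2 := by
    nlinarith
  have hle : (Fintype.card V - t).choose 2 ≤ (Fintype.card V).choose 2 :=
    Nat.choose_le_choose 2 (Nat.sub_le _ _)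
  have hpos : 0 < (Fintype.card V).choose 2 := Nat.choose_pos (by omega)
  obtain ⟨E, hEB, hE⟩ := Finset.exists_subset_card_eq
    (show c ≤ (Tᶜ.offDiag.image (Function.uncurry Sym2.mk)).card by rw [hB]; omega)
  have hsd := Finset.card_sdiff_of_subset hEB
  rw [hB, hE] at hsd
  refine ⟨indicatorColour ⊤ (Tᶜ.offDiag.image (Function.uncurry Sym2.mk) \ E), ?_, fun l hl => ?_⟩
  · have hneg := colourCount_indicatorColour_neg_one (⊤ : SimpleGraph V)
      (B := Tᶜ.offDiag.image (Function.uncurry Sym2.mk) \ E) (by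
        intro e he
        obtain ⟨⟨a, b⟩, hab, rfl⟩ := Finset.mem_image.1 (Finset.mem_sdiff.1 he).1
        simpa using (Finset.mem_offDiag.1 hab).2.2)
    have hadd := colourCount_neg_one_add_colourCount_one
      (indicatorColour (⊤ : SimpleGraph V) (Tᶜ.offDiag.image (Function.uncurry Sym2.mk) \ E))
    omega
  · have := pathSum_indicatorColour_le (T := T) (E := E) (by omega) hl
    rw [hT, hE] at this
    linarith

end Sharpness

end ZeroSumPath

theorem theorem4p2 (n : ℕ) (hn : 3 ≤ n) (c : ℕ) (hc : c = 0 ∨ c = 1)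
    (hmod : (n - 1) / 2 - 1 ≡ c [MOD 2]) :
    (∀ f : (⊤ : SimpleGraph (Fin n)).edgeSet → ({-1, 1} : Set ℤ),
      min (ZeroSumPath.colourCount f (-1)) (ZeroSumPath.colourCount f 1) >
          n.choose 2 - (n - (n - 3) / 4).choose 2 + c →
        ∃ H : (⊤ : SimpleGraph (Fin n)).Subgraph, ZeroSumPath.IsSpanningPath H ∧
          (ZeroSumPath.IsZeroSum f H ∨ ZeroSumPath.IsAlmostZeroSum f H)) ∧
    (∃ f : (⊤ : SimpleGraph (Fin n)).edgeSet → ({-1, 1} : Set ℤ),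
      min (ZeroSumPath.colourCount f (-1)) (ZeroSumPath.colourCount f 1) =
          n.choose 2 - (n - (n - 3) / 4).choose 2 + c ∧
        ¬ ∃ H : (⊤ : SimpleGraph (Fin n)).Subgraph, ZeroSumPath.IsSpanningPath H ∧
          (ZeroSumPath.IsZeroSum f H ∨ ZeroSumPath.IsAlmostZeroSum f H)) := by
  have : Nonempty (Fin n) := ⟨⟨0, by omega⟩⟩
  -- Since `t` is half of `⌊(n-3)/2⌋` rounded down, `c` is the remainder.
  have hs : (n - 1) / 2 - 1 = 2 * ((n - 3) / 4) + c := by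
    unfold Nat.ModEq at hmod
    omega
  have hiff : ∀ f : (⊤ : SimpleGraph (Fin n)).edgeSet → ({-1, 1} : Set ℤ),
      (∃ H : (⊤ : SimpleGraph (Fin n)).Subgraph, ZeroSumPath.IsSpanningPath H ∧
        (ZeroSumPath.IsZeroSum f H ∨ ZeroSumPath.IsAlmostZeroSum f H)) ↔
      ∃ l : List (Fin n), ZeroSumPath.IsHamList l ∧
        |ZeroSumPath.pathSum (fun a b => ZeroSumPath.extendColour f s(a, b)) l| ≤ 1 := by
    intro f
    rw [← ZeroSumPath.exists_isSpanningPath_iff f (fun z => |z| ≤ 1)]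
    refine exists_congr fun H => and_congr_right fun _ => ?_
    rw [ZeroSumPath.IsZeroSum, ZeroSumPath.IsAlmostZeroSum]
    grind
  constructor
  · intro f hf
    rw [hiff]
    refine ZeroSumPath.exists_abs_pathSum_extendColour_le_one f (t := (n - 3) / 4) hc ?_ ?_ ?_
    · rw [Fintype.card_fin]; omega
    · rw [Fintype.card_fin]; omega
    · rwa [Fintype.card_fin]
  · obtain ⟨f, hf, hl⟩ := ZeroSumPath.exists_unbalanced_colouring (V := Fin n)
      (t := (n - 3) / 4) hc (by rw [Fintype.card_fin]; omega)
    rw [Fintype.card_fin] at hf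
    refine ⟨f, hf, ?_⟩
    rw [hiff]
    rintro ⟨l, hham, h⟩
    have := hl l hham
    have := (abs_le.1 h).1
    omega
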